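/- Let $\mathbb{C}$ be a locally small category and let $\mathbb{C}_{fin}$ be a full subcategory of $\mathbb{C}$ such that: (C1) all morphisms of $\mathbb{C}$ are mono; (C2) $\mathrm{Ob}(\mathbb{C}_{fin})$ is a set; (C3) $\hom(A,B)$ is finite for all $A,B\in\mathrm{Ob}(\mathbb{C}_{fin})$; (C4) for every $F\in\mathrm{Ob}(\mathbb{C})$ there is an $A\in\mathrm{Ob}(\mathbb{C}_{fin})$ with $\hom(A,F)\neq\varnothing$; (C5) for every $B\in\mathrm{Ob}(\mathbb{C}_{fin})$ the set $\{A\in\mathrm{Ob}(\mathbb{C}_{fin}) : \hom(A,B)\ne\varnothing\}$ is finite. Let $F\in\mathrm{Ob}(\mathbb{C})$ be - homogeneous: for all $A\in\mathrm{Ob}(\mathbb{C}_{fin})$ and $e_1,e_2\in\hom(A,F)$ there is a $g\in\mathrm{Aut}(F)$ with $g\cdot e_1=e_2$; and - locally finite: for all $A,B\in\mathrm{Ob}(\mathbb{C}_{fin})$, $e\in\hom(A,F)$, $f\in\hom(B,F)$ there are $D\in\mathrm{Ob}(\mathbb{C}_{fin})$, $r\in\hom(D,F)$, $p\in\hom(A,D)$,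 $q\in\hom(B,D)$ with $r\cdot p=e$ and $r\cdot q=f$, and such that for all $H\in\mathrm{Ob}(\mathbb{C})$, $r'\in\hom(H,F)$, $p'\in\hom(A,H)$, $q'\in\hom(B,H)$ with $r'\cdot p'=e$, $r'\cdot q'=f$ there is an $s\in\hom(D,H)$ with $s\cdot p=p'$, $s\cdot q=q'$, $r'\cdot s=r$. Let $\mathbb{A}$ be the full subcategory of $\mathbb{C}_{fin}$ spanned by $\mathrm{Age}(F)=\{A\in\mathrm{Ob}(\mathbb{C}_{fin}):\hom(A,F)\neq\varnothing\}$. Definitions. For objects $A,B,X$ of a category $\mathbb{D}$ with $\hom(A,B)\ne\varnothing$, and integers $k\ge2$, $t\ge1$, write $X\to(B)^A_{k,t}$ if for every $\chi:\hom(A,X)\to\{0,\dots,k-1\}$ there is a $w\in\hom(B,X)$ with $|\chi(w\cdot\hom(A,B))|\le t$. The category $\mathbb{D}$ has the Ramsey property if for all $k\ge2$ and all such $A,B$ there is an $X$ with $X\to(B)^A_{k,1}$. It has finite Ramsey degrees if for every $A$ there is a positive integer $n$ such that for all $k\ge2$ and all such $B$ there is an $X$ with $X\to(B)^A_{k,n}$.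 It is directed if any two objects have morphisms to a common object. An expansion is a functor $U:\mathbb{D}^*\to\mathbb{D}$ between locally small categories that is surjective on objects and injective on hom-sets; for $e\in\hom(A,B)$ and $\mathcal{A}\in U^{-1}(A)$, $\mathcal{B}\in U^{-1}(B)$ write $e\in\hom(\mathcal{A},\mathcal{B})$ if $e$ is the image of a morphism $\mathcal{A}\to\mathcal{B}$. It is reasonable if for all $e\in\hom(A,B)$ and $\mathcal{A}\in U^{-1}(A)$ there is a $\mathcal{B}\in U^{-1}(B)$ with $e\in\hom(\mathcal{A},\mathcal{B})$. It has unique restrictions if for all $\mathcal{B}\in\mathrm{Ob}(\mathbb{D}^*)$ and $e\in\hom(A,U(\mathcal{B}))$ there is a unique $\mathcal{A}\in U^{-1}(A)$ with $e\in\hom(\mathcal{A},\mathcal{B})$. An expansion $U:\mathbb{C}^*\to\mathbb{C}$ is precompact if $U^{-1}(A)$ is a set for all $A\in\mathrm{Ob}(\mathbb{C})$ and a finite set for all $A\in\mathrm{Ob}(\mathbb{C}_{fin})$. An expansion $U:\mathbb{D}^*\to\mathbb{D}$ has the expansion property if for every $A\in\mathrm{Ob}(\mathbb{D})$ there is a $B\in\mathrm{Ob}(\mathbb{D})$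 such that $\hom(\mathcal{A},\mathcal{B})\ne\varnothing$ for all $\mathcal{A}\in U^{-1}(A)$ and $\mathcal{B}\in U^{-1}(B)$. Theorem. The following are equivalent: (1) $\mathbb{A}$ has finite Ramsey degrees. (2) There are a reasonable precompact expansion with unique restrictions $U:\mathbb{C}^*\to\mathbb{C}$ and a full subcategory $\mathbb{A}^*$ of $\mathbb{C}^*$ which is directed and has the Ramsey property, such that $U$ restricts to a functor $U|_{\mathbb{A}^*}:\mathbb{A}^*\to\mathbb{A}$ that is an expansion with unique restrictions and has the expansion property. -/

import Mathlib

open CategoryTheory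

universe v u v' u'

namespace RamseyExpansion

section Setting

variable {C : Type u} [Category.{v} C]

/-- The conditions (C1)--(C5) on a locally small category `C` and the full subcategory of `C`
spanned by the objects satisfying `Cfin`. Sets are `v`-small types, as hom-sets live in `Type v`. -/
structure IsFiniteTemplate (Cfin : ObjectProperty C) : Prop where
  mono : ∀ {A B : C} (f : A ⟶ B), Mono f
  small : _root_.Small.{v} {A : C // Cfin A}
  finite_hom : ∀ A B : C, Cfin A → Cfin B → Finite (A ⟶ B)
  exists_hom : ∀ F : C, ∃ A : C, Cfin A ∧ Nonempty (A ⟶ F)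
  finite_sub : ∀ B : C, Cfin B → {A : C | Cfin A ∧ Nonempty (A ⟶ B)}.Finite

/-- `F` is homogeneous in `C` with respect to `Cfin`. -/
def IsHomogeneous (Cfin : ObjectProperty C) (F : C) : Prop :=
  ∀ A : C, Cfin A → ∀ e₁ e₂ : A ⟶ F, ∃ g : Aut F, e₁ ≫ g.hom = e₂

/-- `F` is locally finite in `C` with respect to `Cfin`. -/
def IsLocallyFinite (Cfin : ObjectProperty C) (F : C) : Prop :=
  ∀ A B : C, Cfin A → Cfin B → ∀ (e : A ⟶ F) (f : B ⟶ F),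
    ∃ (D : C) (r : D ⟶ F) (p : A ⟶ D) (q : B ⟶ D),
      Cfin D ∧ p ≫ r = e ∧ q ≫ r = f ∧
        ∀ (H : C) (r' : H ⟶ F) (p' : A ⟶ H) (q' : B ⟶ H), p' ≫ r' = e → q' ≫ r' = f →
          ∃ s : D ⟶ H, p ≫ s = p' ∧ q ≫ s = q' ∧ s ≫ r' = r

/-- The age of `F`: the objects of `Cfin` that admit a morphism to `F`. -/
def Age (Cfin : ObjectProperty C) (F : C) : ObjectProperty C :=
  fun A => Cfin A ∧ Nonempty (A ⟶ F)

end Setting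

section Ramsey

variable {C : Type u} [Category.{v} C]

/-- The arrow `X ⟶ (B)^A_{k,t}`: for every colouring `χ` of `hom(A, X)` by `k` colours there is a
morphism `w : B ⟶ X` such that `χ` takes at most `t` values on `w · hom(A, B)`. -/
def RamseyArrow (X B A : C) (k t : ℕ) : Prop :=
  ∀ χ : (A ⟶ X) → Fin k, ∃ w : B ⟶ X, (Set.range fun f : A ⟶ B => χ (f ≫ w)).ncard ≤ t

variable (C) in
/-- The Ramsey property (for morphisms). -/
def HasRamseyProperty : Prop :=
  ∀ k : ℕ, 2 ≤ k → ∀ A B : C, Nonempty (A ⟶ B) → ∃ X : C, RamseyArrow X B A k 1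

/-- The Ramsey degree of `A` in `C`: the least positive integer `n` such that for all `k ≥ 2` and
all `B` (with `A ⟶ B`) there is an `X` with `X ⟶ (B)^A_{k,n}`, and `⊤` if there is none. -/
noncomputable def ramseyDegree (A : C) : ℕ∞ :=
  sInf {d : ℕ∞ | ∃ n : ℕ, d = n ∧ 0 < n ∧
    ∀ k : ℕ, 2 ≤ k → ∀ B : C, Nonempty (A ⟶ B) → ∃ X : C, RamseyArrow X B A k n}

variable (C) in
/-- All Ramsey degrees of objects of `C` are finite. -/
def HasFiniteRamseyDegrees : Prop :=
  ∀ A : C, ramseyDegree A < ⊤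

variable (C) in
/-- Any two objects of `C` have morphisms into a common object. -/
def IsDirectedCategory : Prop :=
  ∀ A B : C, ∃ X : C, Nonempty (A ⟶ X) ∧ Nonempty (B ⟶ X)

end Ramsey

section Expansions

variable {C : Type u} [Category.{v} C] {D : Type u'} [Category.{v'} D]

/-- `U : D ⥤ C` is an expansion of `C`: surjective on objects and injective on hom-sets. -/
structure IsExpansion (U : D ⥤ C) : Prop where
  surjective_obj : Function.Surjective U.obj
  faithful : U.Faithful

/-- `e ∈ hom(𝒜, ℬ)`: the morphism `e : A ⟶ B` is the image under `U` of a morphism `𝒜 ⟶ ℬ`.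
In particular `U.obj 𝒜 = A` and `U.obj ℬ = B`. -/
def LiftsTo (U : D ⥤ C) {A B : C} (e : A ⟶ B) (𝒜 ℬ : D) : Prop :=
  ∃ φ : 𝒜 ⟶ ℬ, U.IsHomLift e φ

/-- `U` is reasonable. -/
def IsReasonable (U : D ⥤ C) : Prop :=
  ∀ {A B : C} (e : A ⟶ B) (𝒜 : D), U.obj 𝒜 = A → ∃ ℬ : D, LiftsTo U e 𝒜 ℬ

/-- `U` has unique restrictions. -/
def HasUniqueRestrictions (U : D ⥤ C) : Prop :=
  ∀ (ℬ : D) {A : C} (e : A ⟶ U.obj ℬ), ∃! 𝒜 : D, LiftsTo U e 𝒜 ℬ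

/-- `U` is precompact: all fibres are sets, and the fibres over the objects of `Cfin` are finite. -/
structure IsPrecompact (Cfin : ObjectProperty C) (U : D ⥤ C) : Prop where
  small : ∀ A : C, _root_.Small.{v} {𝒜 : D // U.obj 𝒜 = A}
  finite : ∀ A : C, Cfin A → Finite {𝒜 : D // U.obj 𝒜 = A}

/-- `U` has the expansion property. -/
def HasExpansionProperty (U : D ⥤ C) : Prop :=
  ∀ A : C, ∃ B : C, ∀ 𝒜 ℬ : D, U.obj 𝒜 = A → U.obj ℬ = B → Nonempty (𝒜 ⟶ ℬ)

/-- The functor between full subcategories that is obtained by restricting `U`. -/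
def restrictFull (U : D ⥤ C) (P : ObjectProperty D) (Q : ObjectProperty C)
    (h : ∀ 𝒜 : D, P 𝒜 → Q (U.obj 𝒜)) : P.FullSubcategory ⥤ Q.FullSubcategory :=
  Q.lift (P.ι ⋙ U) fun 𝒜 => h 𝒜.obj 𝒜.property

end Expansions

end RamseyExpansion

open RamseyExpansion

namespace RamseyExpansion

/-! From an expansion to finite degrees: the finitely many expansions of `A` can be made
monochromatic one after another, and by unique restrictions each copy of `A` comes from exactly one
of them. So at most as many colours survive as the fibre over `A` has elements.

Conversely, let `n A` be the exact degree of `A`. Its minimality yields an object `B A` and, on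
every object, a colouring taking at least `n A` values on each copy of `B A`. Recording such
colourings for all `A` at once expands the age; by Zorn's lemma and finiteness of fibres, the
hereditary class of these expansions contains a minimal one, `K`. Minimality gives the expansion
property. It also gives the Ramsey property: `K` has at least `n A` expansions of `A`, all realised
in every copy of a suitable `B`. A colouring that refines the type and takes at most `n A` values on
a copy of `B` must then be a function of the type alone. Local finiteness enters through
directedness of the age. -/

theorem ncard_range_le_card {α β γ : Type*} [Finite γ] (c : α → β) (T : α → γ)
    (h : ∀ x y, T x = T y → c x = c y) : (Set.range c).ncard ≤ Nat.card γ := by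
  classical
  have hs : ∀ y : Set.range c, ∃ x, c x = y := fun y => y.2
  choose s hs using hs
  rw [← Nat.card_coe_set_eq]
  refine Nat.card_le_card_of_injective (fun y => T (s y)) fun y z hyz => ?_
  have := h _ _ hyz
  rw [hs, hs] at this
  exact Subtype.ext this

/-! ### Exact degrees, and finite degrees from a Ramsey expansion -/

section FiniteDegrees

variable {C : Type u} [Category.{v} C]

theorem ramseyDegree_lt_top_of_forall_arrow {A : C} {n : ℕ} (hn : 0 < n)
    (h : ∀ k : ℕ, 2 ≤ k → ∀ B : C, Nonempty (A ⟶ B) → ∃ X : C, RamseyArrow X B A k n) :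
    ramseyDegree A < ⊤ :=
  lt_of_le_of_lt (sInf_le ⟨n, rfl, hn, h⟩) (ENat.natCast_lt_top n)

/-- A finite Ramsey degree `n` is attained, and it is witnessed by colourings which take at least
`n` values on every copy of a fixed object. -/
theorem exists_of_ramseyDegree_lt_top {A : C} (h : ramseyDegree A < ⊤) :
    ∃ n : ℕ, (∀ k : ℕ, 2 ≤ k → ∀ B : C, Nonempty (A ⟶ B) → ∃ X : C, RamseyArrow X B A k n) ∧
      ∃ (k : ℕ) (B : C), ∀ X : C, ∃ χ : (A ⟶ X) → Fin (k + 1), ∀ w : B ⟶ X,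
        n ≤ (Set.range fun f : A ⟶ B => χ (f ≫ w)).ncard := by
  classical
  have hex : ∃ n : ℕ, 0 < n ∧
      ∀ k : ℕ, 2 ≤ k → ∀ B : C, Nonempty (A ⟶ B) → ∃ X : C, RamseyArrow X B A k n := by
    by_contra hno
    refine h.ne (sInf_eq_top.2 ?_)
    rintro d ⟨n, -, hn⟩
    exact (hno ⟨n, hn⟩).elim
  obtain ⟨n, ⟨hpos, harrow⟩, hmin⟩ := (⟨Nat.find hex, Nat.find_spec hex, fun _ => Nat.find_min hex⟩ :
    ∃ n, (0 < n ∧ ∀ k : ℕ, 2 ≤ k → ∀ B : C, Nonempty (A ⟶ B) → ∃ X : C, RamseyArrow X B A k n) ∧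
      ∀ m < n, ¬(0 < m ∧
        ∀ k : ℕ, 2 ≤ k → ∀ B : C, Nonempty (A ⟶ B) → ∃ X : C, RamseyArrow X B A k m))
  refine ⟨n, harrow, ?_⟩
  -- Degree 1 is separate because minimality says nothing about `n - 1 = 0`; there a constant
  -- colouring suffices.
  obtain rfl | h1 : n = 1 ∨ 1 < n := by omega
  · refine ⟨0, A, fun X => ⟨fun _ => 0, fun w => ?_⟩⟩
    rw [Nat.one_le_iff_ne_zero, Ne, Set.ncard_eq_zero]
    exact (Set.range_nonempty_iff_nonempty.2 ⟨𝟙 A⟩).ne_empty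
  · have hmin := hmin (n - 1) (by omega)
    push Not at hmin
    obtain ⟨k, hk, B, -, hB⟩ := hmin (by omega)
    obtain ⟨k, rfl⟩ : ∃ m, k = m + 1 := ⟨k - 1, by omega⟩
    refine ⟨k, B, fun X => ?_⟩
    have hX := hB X
    unfold RamseyArrow at hX
    push Not at hX
    obtain ⟨χ, hχ⟩ := hX
    exact ⟨χ, fun w => by have := hχ w; omega⟩

/-- Iterated Ramsey arrows: handle the new `A` in an outer object `Y`, then pull the remaining
colourings back to the copy of `X` found there. -/
theorem HasRamseyProperty.exists_forall_monochromatic (hR : HasRamseyProperty C) {k : ℕ}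
    (hk : 2 ≤ k) {s : Set C} (hs : s.Finite) (B : C) :
    ∃ X : C, ∀ χ : ∀ A : C, (A ⟶ X) → Fin k, ∃ w : B ⟶ X, ∀ A ∈ s, ∀ f g : A ⟶ B,
      χ A (f ≫ w) = χ A (g ≫ w) := by
  induction s, hs using Set.Finite.induction_on with
  | empty => exact ⟨B, fun _ => ⟨𝟙 B, fun _ h => h.elim⟩⟩
  | @insert A s _ _ ih =>
    obtain ⟨X, hX⟩ := ih
    by_cases hA : Nonempty (A ⟶ X)
    · obtain ⟨Y, hY⟩ := hR k hk A X hA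
      refine ⟨Y, fun χ => ?_⟩
      obtain ⟨v, hv⟩ := hY (χ A)
      obtain ⟨w, hw⟩ := hX fun A' e => χ A' (e ≫ v)
      refine ⟨w ≫ v, ?_⟩
      rintro A' (rfl | hA') f g
      · rw [Set.ncard_le_one] at hv
        simpa using hv _ ⟨f ≫ w, rfl⟩ _ ⟨g ≫ w, rfl⟩
      · simpa using hw A' hA' f g
    · refine ⟨X, fun χ => ?_⟩
      obtain ⟨w, hw⟩ := hX χ
      refine ⟨w, ?_⟩
      rintro A' (rfl | hA') f g
      · exact (hA ⟨f ≫ w⟩).elim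
      · exact hw A' hA' f g

theorem ramseyDegree_lt_top_of_expansion {D : Type u'} [Category.{v'} D] {U : D ⥤ C}
    (hU : IsExpansion U) (hr : HasUniqueRestrictions U) (hR : HasRamseyProperty D) (A : C)
    (hA : {𝒜 : D | U.obj 𝒜 = A}.Finite) : ramseyDegree A < ⊤ := by
  classical
  have : Finite {𝒜 : D // U.obj 𝒜 = A} := hA
  obtain ⟨𝒜₀, h₀⟩ := hU.surjective_obj A
  have : Nonempty {𝒜 : D // U.obj 𝒜 = A} := ⟨⟨𝒜₀, h₀⟩⟩
  refine ramseyDegree_lt_top_of_forall_arrow (n := Nat.card {𝒜 : D // U.obj 𝒜 = A})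
    Nat.card_pos fun k hk B _ => ?_
  obtain ⟨ℬ, rfl⟩ := hU.surjective_obj B
  obtain ⟨𝒳, h𝒳⟩ := hR.exists_forall_monochromatic hk hA ℬ
  -- Makes `0` available as a dummy colour outside the fibre over `A`.
  obtain ⟨k, rfl⟩ : ∃ m, k = m + 1 := ⟨k - 1, by omega⟩
  refine ⟨U.obj 𝒳, fun χ => ?_⟩
  obtain ⟨w, hw⟩ := h𝒳 fun 𝒜 e =>
    if h : U.obj 𝒜 = A then χ (eqToHom h.symm ≫ U.map e) else 0
  refine ⟨U.map w, ?_⟩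
  have hlift : ∀ f : A ⟶ U.obj ℬ, ∃ (𝒜 : {𝒜 : D // U.obj 𝒜 = A}) (φ : 𝒜.1 ⟶ ℬ),
      f = eqToHom 𝒜.2.symm ≫ U.map φ := by
    intro f
    obtain ⟨𝒜, ⟨φ, hφ⟩, -⟩ := hr ℬ f
    exact ⟨⟨𝒜, IsHomLift.domain_eq U f φ⟩, φ, by simpa using IsHomLift.fac U f φ⟩
  choose T φ hφ using hlift
  refine ncard_range_le_card _ T fun f g hfg => ?_
  have key : ∀ f, χ (f ≫ U.map w) =
      χ (eqToHom (T f).2.symm ≫ U.map (φ f ≫ w)) := by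
    intro f
    rw [U.map_comp, ← Category.assoc, ← hφ]
  have aux : ∀ (𝒜 ℬ' : {𝒜 : D // U.obj 𝒜 = A}) (a : 𝒜.1 ⟶ ℬ) (b : ℬ'.1 ⟶ ℬ), 𝒜 = ℬ' →
      χ (eqToHom 𝒜.2.symm ≫ U.map (a ≫ w)) = χ (eqToHom ℬ'.2.symm ≫ U.map (b ≫ w)) := by
    rintro 𝒜 _ a b rfl
    have := hw 𝒜.1 𝒜.2 a b
    rwa [dif_pos 𝒜.2, dif_pos 𝒜.2] at this
  exact (key f).trans ((aux _ _ _ _ hfg).trans (key g).symm)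

end FiniteDegrees

end RamseyExpansion

namespace RamseyExpansion

/-! ### The expansion by colourings, and minimal hereditary classes -/

section ColoredObjects

variable {C : Type u} [Category.{v} C] {P : ObjectProperty C}

/-- An object of `C` with a colouring of the morphisms `X ⟶ obj` for every `X` in `P`. -/
structure ColoredObject (k : P.FullSubcategory → ℕ) where
  obj : C
  color : ∀ X : P.FullSubcategory, (X.obj ⟶ obj) → Fin (k X + 1)

namespace ColoredObject

variable {k : P.FullSubcategory → ℕ}

/-- A morphism of coloured objects is a morphism which preserves all colours. -/
@[ext]
structure Hom (𝒜 ℬ : ColoredObject k) where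
  hom : 𝒜.obj ⟶ ℬ.obj
  color_comp : ∀ (X : P.FullSubcategory) (e : X.obj ⟶ 𝒜.obj),
    ℬ.color X (e ≫ hom) = 𝒜.color X e

instance : Category.{v} (ColoredObject k) where
  Hom := Hom
  id 𝒜 := ⟨𝟙 𝒜.obj, by simp⟩
  comp f g := ⟨f.hom ≫ g.hom, fun X e => by
    rw [← Category.assoc, g.color_comp, f.color_comp]⟩
  id_comp f := Hom.ext (Category.id_comp f.hom)
  comp_id f := Hom.ext (Category.comp_id f.hom)
  assoc f g h := Hom.ext (Category.assoc f.hom g.hom h.hom)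

/-- The functor that forgets the colours. -/
def forget (k : P.FullSubcategory → ℕ) : ColoredObject k ⥤ C where
  obj 𝒜 := 𝒜.obj
  map f := Hom.hom f

/-- The colouring induced on the domain of a morphism. -/
def restrict (ℬ : ColoredObject k) {A : C} (f : A ⟶ ℬ.obj) : ColoredObject k :=
  ⟨A, fun X e => ℬ.color X (e ≫ f)⟩

/-- The morphism from a restriction. -/
def restrictHom (ℬ : ColoredObject k) {A : C} (f : A ⟶ ℬ.obj) : ℬ.restrict f ⟶ ℬ :=
  ⟨f, fun _ _ => rfl⟩

theorem eq_restrict {𝒜 ℬ : ColoredObject k} (φ : 𝒜 ⟶ ℬ) : 𝒜 = ℬ.restrict φ.hom := by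
  obtain ⟨A, c⟩ := 𝒜
  simp only [restrict, ColoredObject.mk.injEq, heq_eq_eq, true_and]
  funext X e
  exact (φ.color_comp X e).symm

theorem isExpansion_forget (k : P.FullSubcategory → ℕ) : IsExpansion (forget k) where
  surjective_obj A := ⟨⟨A, fun _ _ => 0⟩, rfl⟩
  faithful := ⟨fun h => Hom.ext h⟩

theorem liftsTo_forget {𝒜 ℬ : ColoredObject k} (φ : 𝒜 ⟶ ℬ) :
    LiftsTo (forget k) φ.hom 𝒜 ℬ :=
  ⟨φ, Functor.IsHomLift.map (p := forget k) φ⟩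

theorem isReasonable_forget (k : P.FullSubcategory → ℕ)
    (hC : ∀ {A B : C} (f : A ⟶ B), Mono f) : IsReasonable (forget k) := by
  classical
  rintro _ B e 𝒜 rfl
  -- Push the colours forward along `e`, with `0` off its image; this is well defined because `e` is
  -- mono.
  let ℬ : ColoredObject k := ⟨B, fun X f =>
    if h : ∃ g : X.obj ⟶ 𝒜.obj, g ≫ e = f then 𝒜.color X h.choose else 0⟩
  refine ⟨ℬ, liftsTo_forget (ℬ := ℬ) ⟨e, fun X g => ?_⟩⟩
  have h : ∃ g' : X.obj ⟶ 𝒜.obj, g' ≫ e = g ≫ e := ⟨g, rfl⟩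
  have := hC e
  exact (dif_pos h).trans (congrArg _ ((cancel_mono e).1 h.choose_spec))

theorem hasUniqueRestrictions_forget (k : P.FullSubcategory → ℕ) :
    HasUniqueRestrictions (forget k) := by
  intro ℬ A e
  refine ⟨ℬ.restrict e, liftsTo_forget (ℬ.restrictHom e), ?_⟩
  rintro 𝒜 ⟨φ, hφ⟩
  obtain rfl : (forget k).obj 𝒜 = A := IsHomLift.domain_eq (forget k) e φ
  obtain rfl : e = φ.hom := IsHomLift.eq_of_isHomLift (forget k) e φ
  exact eq_restrict φ

/-- The fibre of the forgetful functor over `A` consists of the colourings of `A`. -/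
def fiberEquiv (k : P.FullSubcategory → ℕ) (A : C) :
    {𝒜 : ColoredObject k // 𝒜.obj = A} ≃
      ∀ X : P.FullSubcategory, (X.obj ⟶ A) → Fin (k X + 1) where
  toFun 𝒜 X e := 𝒜.1.color X (e ≫ eqToHom 𝒜.2.symm)
  invFun c := ⟨⟨A, c⟩, rfl⟩
  left_inv := by
    rintro ⟨⟨_, c⟩, rfl⟩
    simp
  right_inv c := by simp

theorem finite_fiber (k : P.FullSubcategory → ℕ) (A : C)
    (hA : {X : C | P X ∧ Nonempty (X ⟶ A)}.Finite)
    (hfin : ∀ X : C, P X → Finite (X ⟶ A)) :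
    Finite {𝒜 : ColoredObject k // 𝒜.obj = A} := by
  have : Finite {X : C // P X ∧ Nonempty (X ⟶ A)} := hA
  have (X : {X : C // P X ∧ Nonempty (X ⟶ A)}) : Finite (X.1 ⟶ A) := hfin X.1 X.2.1
  let res : (∀ X : P.FullSubcategory, (X.obj ⟶ A) → Fin (k X + 1)) →
      ∀ X : {X : C // P X ∧ Nonempty (X ⟶ A)}, (X.1 ⟶ A) → Fin (k ⟨X.1, X.2.1⟩ + 1) :=
    fun c X => c ⟨X.1, X.2.1⟩
  refine Finite.of_injective (res ∘ fiberEquiv k A) (.comp ?_ (fiberEquiv k A).injective)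
  intro c d h
  funext X e
  exact congrFun (congrFun h ⟨X.obj, X.property, ⟨e⟩⟩) e

theorem isPrecompact_forget (k : P.FullSubcategory → ℕ) {Cfin : ObjectProperty C}
    (hC : IsFiniteTemplate Cfin) (hP : P ≤ Cfin) : IsPrecompact Cfin (forget k) where
  small A := by
    have := hC.small
    have : _root_.Small.{v} P.FullSubcategory :=
      small_of_injective (β := {A : C // Cfin A}) (f := fun X => ⟨X.obj, hP _ X.property⟩)
        fun X Y h => by
          obtain ⟨X, _⟩ := X
          obtain ⟨Y, _⟩ := Y
          cases h
          rfl
    exact small_map (fiberEquiv k A)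
  finite A hA := finite_fiber k A ((hC.finite_sub A hA).subset fun X hX => ⟨hP _ hX.1, hX.2⟩)
    fun X hX => hC.finite_hom X A (hP _ hX) hA

/-- A class of coloured objects over `P` that is closed under restrictions and has nonempty
fibres. -/
structure IsHereditaryClass (K : Set (ColoredObject k)) : Prop where
  prop : ∀ 𝒜 ∈ K, P 𝒜.obj
  restrict_mem : ∀ ℬ ∈ K, ∀ {A : C}, P A → ∀ f : A ⟶ ℬ.obj, ℬ.restrict f ∈ K
  exists_mem : ∀ A : C, P A → ∃ 𝒜 ∈ K, 𝒜.obj = A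

theorem IsHereditaryClass.exists_minimal {K₀ : Set (ColoredObject k)}
    (hK₀ : IsHereditaryClass K₀)
    (hfin : ∀ A : C, P A → {𝒜 : ColoredObject k | 𝒜.obj = A}.Finite) :
    ∃ K ⊆ K₀, Minimal IsHereditaryClass K := by
  refine zorn_superset_nonempty {K | IsHereditaryClass K} ?_ K₀ hK₀
  rintro c hc hchain ⟨K₁, hK₁⟩
  refine ⟨⋂₀ c, ⟨fun 𝒜 h𝒜 => (hc hK₁).prop 𝒜 (h𝒜 K₁ hK₁), fun ℬ hℬ A hA f K hK =>
    (hc hK).restrict_mem ℬ (hℬ K hK) hA f, fun A hA => ?_⟩, fun K hK => Set.sInter_subset_of_mem hK⟩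
  by_contra! hno
  -- Compactness: if the intersection misses a finite fibre, a single member of the chain already
  -- misses it.
  have key : ∀ S : Set (ColoredObject k), S.Finite → (∀ 𝒜 ∈ S, 𝒜 ∉ ⋂₀ c) →
      ∃ K ∈ c, ∀ 𝒜 ∈ S, 𝒜 ∉ K := by
    intro S hS
    induction S, hS using Set.Finite.induction_on with
    | empty => exact fun _ => ⟨K₁, hK₁, by simp⟩
    | @insert 𝒜 S _ _ ih =>
      intro h
      obtain ⟨K, hK, hKS⟩ := ih fun ℬ hℬ => h ℬ (.inr hℬ)
      obtain ⟨L, hL, h𝒜⟩ : ∃ L ∈ c, 𝒜 ∉ L := by simpa using h 𝒜 (.inl rfl)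
      obtain hKL | hLK := hchain.total hK hL
      · refine ⟨K, hK, ?_⟩
        rintro ℬ (rfl | hℬ)
        exacts [fun h => h𝒜 (hKL h), hKS ℬ hℬ]
      · refine ⟨L, hL, ?_⟩
        rintro ℬ (rfl | hℬ)
        exacts [h𝒜, fun h => hKS ℬ hℬ (hLK h)]
  obtain ⟨K, hK, h⟩ := key _ (hfin A hA) fun 𝒜 h𝒜 hmem => hno 𝒜 hmem h𝒜
  obtain ⟨𝒜, h𝒜, hA𝒜⟩ := (hc hK).exists_mem A hA
  exact h 𝒜 hA𝒜 h𝒜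

section Minimal

variable {K : Set (ColoredObject k)}

/-- Otherwise the members of `K` not receiving `𝒜` would form a hereditary class, and it is strictly
smaller since `𝒜` receives itself. -/
theorem exists_forall_hom_of_minimal (hK : Minimal IsHereditaryClass K) {𝒜 : ColoredObject k} (h𝒜 : 𝒜 ∈ K) :
    ∃ B : C, P B ∧ ∀ ℬ ∈ K, ℬ.obj = B → Nonempty (𝒜 ⟶ ℬ) := by
  by_contra! hno
  have hK' : IsHereditaryClass {ℬ | ℬ ∈ K ∧ IsEmpty (𝒜 ⟶ ℬ)} := by
    refine ⟨fun ℬ hℬ => hK.1.prop ℬ hℬ.1, fun ℬ hℬ A hA f =>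
      ⟨hK.1.restrict_mem ℬ hℬ.1 hA f, ⟨fun φ => hℬ.2.false (φ ≫ ℬ.restrictHom f)⟩⟩,
      fun A hA => ?_⟩
    obtain ⟨ℬ, hℬ, hA, he⟩ := hno A hA
    exact ⟨ℬ, ⟨hℬ, he⟩, hA⟩
  exact (hK.2 hK' (fun ℬ hℬ => hℬ.1) h𝒜).2.false (𝟙 𝒜)

theorem exists_forall_hom_of_minimal_of_finite (hK : Minimal IsHereditaryClass K)
    (hdir : ∀ A B : C, P A → P B → ∃ D : C, P D ∧ Nonempty (A ⟶ D) ∧ Nonempty (B ⟶ D))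
    {S : Set (ColoredObject k)} (hS : S.Finite) (hSK : S ⊆ K) (hne : ∃ A, P A) :
    ∃ B : C, P B ∧ ∀ ℬ ∈ K, ℬ.obj = B → ∀ 𝒜 ∈ S, Nonempty (𝒜 ⟶ ℬ) := by
  induction S, hS using Set.Finite.induction_on with
  | empty =>
    obtain ⟨A, hA⟩ := hne
    exact ⟨A, hA, by simp⟩
  | @insert 𝒜 S _ _ ih =>
    obtain ⟨B, hB, hBS⟩ := ih fun ℬ hℬ => hSK (.inr hℬ)
    obtain ⟨B', hB', hB'𝒜⟩ := exists_forall_hom_of_minimal hK (hSK (.inl rfl))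
    obtain ⟨D, hD, ⟨f⟩, ⟨g⟩⟩ := hdir B B' hB hB'
    refine ⟨D, hD, ?_⟩
    rintro ℬ hℬ rfl 𝒜' (rfl | h𝒜')
    · obtain ⟨φ⟩ := hB'𝒜 _ (hK.1.restrict_mem ℬ hℬ hB' g) rfl
      exact ⟨φ ≫ ℬ.restrictHom g⟩
    · obtain ⟨φ⟩ := hBS _ (hK.1.restrict_mem ℬ hℬ hB f) rfl 𝒜' h𝒜'
      exact ⟨φ ≫ ℬ.restrictHom f⟩

/-- The Ramsey property of a minimal hereditary class in which the fibre over the object `A` is at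
least as large as the Ramsey degree of `A`. -/
theorem exists_ramseyArrow_of_minimal (hK : Minimal IsHereditaryClass K)
    (hdir : ∀ A B : C, P A → P B → ∃ D : C, P D ∧ Nonempty (A ⟶ D) ∧ Nonempty (B ⟶ D))
    {𝒜 ℬ : ColoredObject k} (h𝒜 : 𝒜 ∈ K) (hℬ : ℬ ∈ K) (h : Nonempty (𝒜 ⟶ ℬ)) {n : ℕ}
    (hfin : {𝒜' : ColoredObject k | 𝒜'.obj = 𝒜.obj}.Finite)
    (hn : n ≤ {𝒜' ∈ K | 𝒜'.obj = 𝒜.obj}.ncard)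
    (hR : ∀ l : ℕ, 2 ≤ l → ∀ B : C, P B → Nonempty (𝒜.obj ⟶ B) → ∃ X : C, P X ∧
      ∀ χ : (𝒜.obj ⟶ X) → Fin l, ∃ w : B ⟶ X,
        (Set.range fun f : 𝒜.obj ⟶ B => χ (f ≫ w)).ncard ≤ n) (l : ℕ) :
    ∃ 𝒳 ∈ K, ∀ χ : (𝒜 ⟶ 𝒳) → Fin l, ∃ w : ℬ ⟶ 𝒳, ∀ f g : 𝒜 ⟶ ℬ,
      χ (f ≫ w) = χ (g ≫ w) := by
  classical
  have hfin' : {𝒜' ∈ K | 𝒜'.obj = 𝒜.obj}.Finite := hfin.subset fun _ h => h.2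
  have : Finite {𝒜' : ColoredObject k // 𝒜'.obj = 𝒜.obj} := hfin
  obtain ⟨B, hB, hBS⟩ := exists_forall_hom_of_minimal_of_finite hK hdir (hfin'.insert ℬ)
    (Set.insert_subset hℬ fun _ h => h.1) ⟨_, hK.1.prop 𝒜 h𝒜⟩
  obtain ⟨ℬ', hℬ', rfl⟩ := hK.1.exists_mem B hB
  obtain ⟨φ⟩ := h
  obtain ⟨ψ⟩ := hBS ℬ' hℬ' rfl ℬ (.inl rfl)
  -- Colours record the type of a copy of `𝒜.obj`, and `χ` on the copies of `𝒜`.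
  let Γ := {𝒜' : ColoredObject k // 𝒜'.obj = 𝒜.obj} × Option (Fin l)
  -- The `+ 2` only ensures at least two colours.
  let ε : Γ ↪ Fin (Nat.card Γ + 2) :=
    (Finite.equivFin Γ).toEmbedding.trans (Fin.castAddEmb 2)
  obtain ⟨X, hX, harrow⟩ := hR (Nat.card Γ + 2) (by omega) ℬ'.obj hB ⟨(φ ≫ ψ).hom⟩
  obtain ⟨𝒳, h𝒳, rfl⟩ := hK.1.exists_mem X hX
  refine ⟨𝒳, h𝒳, fun χ => ?_⟩
  let χ' : (𝒜.obj ⟶ 𝒳.obj) → Γ := fun e => ⟨⟨𝒳.restrict e, rfl⟩,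
    if h : ∃ φ : 𝒜 ⟶ 𝒳, φ.hom = e then some (χ h.choose) else none⟩
  have hχ' : ∀ φ : 𝒜 ⟶ 𝒳, (χ' φ.hom).2 = some (χ φ) := by
    intro φ
    have h : ∃ φ' : 𝒜 ⟶ 𝒳, φ'.hom = φ.hom := ⟨φ, rfl⟩
    refine (dif_pos h).trans ?_
    rw [show h.choose = φ from Hom.ext h.choose_spec]
  obtain ⟨w, hw⟩ := harrow (ε ∘ χ')
  have h𝒴 := hK.1.restrict_mem 𝒳 h𝒳 hB w
  obtain ⟨θ⟩ := hBS _ h𝒴 rfl ℬ (.inl rfl)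
  refine ⟨θ ≫ 𝒳.restrictHom w, fun f g => ?_⟩
  set R : Set Γ := Set.range fun f : 𝒜.obj ⟶ ℬ'.obj => χ' (f ≫ w) with hRdef
  have hRcard : R.ncard ≤ n := by
    refine le_trans (le_of_eq ?_) hw
    rw [← Set.ncard_image_of_injective R ε.injective, hRdef, ← Set.range_comp]
    rfl
  -- Every type occurs in the copy `w`, so `R`, with at most `n` elements, projects onto at least
  -- `n` types; hence the projection is injective on `R`.
  have himage : {𝒜' ∈ K | 𝒜'.obj = 𝒜.obj} ⊆ (fun y : Γ => y.1.1) '' R := by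
    intro 𝒜' h𝒜'
    obtain ⟨η⟩ := hBS _ h𝒴 rfl 𝒜' (.inr h𝒜')
    obtain ⟨A', c⟩ := 𝒜'
    obtain rfl : A' = 𝒜.obj := h𝒜'.2
    exact ⟨_, ⟨η.hom, rfl⟩, (eq_restrict (η ≫ 𝒳.restrictHom w)).symm⟩
  have hRfin : R.Finite := Set.toFinite R
  have hinj : Set.InjOn (fun y : Γ => y.1.1) R := by
    refine Set.injOn_of_ncard_image_eq (le_antisymm (Set.ncard_image_le hRfin) ?_) hRfin
    exact hRcard.trans (hn.trans (Set.ncard_le_ncard himage (hRfin.image _)))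
  have hval := hinj ⟨(f ≫ θ).hom, rfl⟩ ⟨(g ≫ θ).hom, rfl⟩
    ((eq_restrict ((f ≫ θ) ≫ 𝒳.restrictHom w)).symm.trans
      (eq_restrict ((g ≫ θ) ≫ 𝒳.restrictHom w)))
  have h2 := (hχ' ((f ≫ θ) ≫ 𝒳.restrictHom w)).symm.trans
    ((congrArg Prod.snd hval).trans (hχ' ((g ≫ θ) ≫ 𝒳.restrictHom w)))
  rw [Category.assoc, Category.assoc] at h2
  exact Option.some.inj h2

end Minimal

end ColoredObject

end ColoredObjects

end RamseyExpansion

namespace RamseyExpansion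

/-! ### Restriction to the age and the equivalence -/

section Main

variable {C : Type u} [Category.{v} C]

theorem IsLocallyFinite.age_directed {Cfin : ObjectProperty C} {F : C}
    (h : IsLocallyFinite Cfin F) (A B : C) (hA : Age Cfin F A) (hB : Age Cfin F B) :
    ∃ D : C, Age Cfin F D ∧ Nonempty (A ⟶ D) ∧ Nonempty (B ⟶ D) := by
  obtain ⟨hA, ⟨e⟩⟩ := hA
  obtain ⟨hB, ⟨f⟩⟩ := hB
  obtain ⟨D, r, p, q, hD, -⟩ := h A B hA hB e f
  exact ⟨D, ⟨hD, ⟨r⟩⟩, ⟨p⟩, ⟨q⟩⟩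

namespace ColoredObject

variable {P : ObjectProperty C} {k : P.FullSubcategory → ℕ} {K : Set (ColoredObject k)}

theorem isExpansion_restrictFull (hK : IsHereditaryClass K) :
    IsExpansion (restrictFull (forget k) (fun 𝒜 => 𝒜 ∈ K) P hK.prop) where
  surjective_obj A := by
    obtain ⟨𝒜, h𝒜, hA⟩ := hK.exists_mem A.obj A.property
    exact ⟨⟨𝒜, h𝒜⟩, ObjectProperty.FullSubcategory.ext hA⟩
  faithful := ⟨fun {_ _ f g} h => ObjectProperty.hom_ext _
    (Hom.ext (congrArg InducedCategory.Hom.hom h))⟩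

theorem hasUniqueRestrictions_restrictFull (hK : IsHereditaryClass K) :
    HasUniqueRestrictions (restrictFull (forget k) (fun 𝒜 => 𝒜 ∈ K) P hK.prop) := by
  intro ℬ A e
  let V := restrictFull (forget k) (fun 𝒜 => 𝒜 ∈ K) P hK.prop
  let 𝒜 : ObjectProperty.FullSubcategory (fun 𝒜 : ColoredObject k => 𝒜 ∈ K) :=
    ⟨ℬ.obj.restrict e.hom, hK.restrict_mem ℬ.obj ℬ.property A.property e.hom⟩
  let φ : 𝒜 ⟶ ℬ := ObjectProperty.homMk (ℬ.obj.restrictHom e.hom)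
  have hφ : V.IsHomLift e φ := Functor.IsHomLift.map (p := V) φ
  refine ⟨𝒜, ⟨φ, hφ⟩, ?_⟩
  rintro 𝒜' ⟨φ', hφ'⟩
  have hφ' : V.IsHomLift e φ' := hφ'
  obtain rfl : V.obj 𝒜' = A := IsHomLift.domain_eq V e φ'
  obtain rfl : e = V.map φ' := IsHomLift.eq_of_isHomLift V e φ'
  exact ObjectProperty.FullSubcategory.ext (eq_restrict φ'.hom)

theorem hasExpansionProperty_restrictFull (hK : Minimal IsHereditaryClass K)
    (hdir : ∀ A B : C, P A → P B → ∃ D : C, P D ∧ Nonempty (A ⟶ D) ∧ Nonempty (B ⟶ D))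
    (hfin : ∀ A : C, P A → {𝒜 : ColoredObject k | 𝒜.obj = A}.Finite) :
    HasExpansionProperty (restrictFull (forget k) (fun 𝒜 => 𝒜 ∈ K) P hK.1.prop) := by
  intro A
  obtain ⟨B, hB, h⟩ := exists_forall_hom_of_minimal_of_finite hK hdir
    ((hfin A.obj A.property).subset fun 𝒜 (h𝒜 : 𝒜 ∈ K ∧ 𝒜.obj = A.obj) => h𝒜.2)
    (fun _ h => h.1) ⟨_, A.property⟩
  refine ⟨⟨B, hB⟩, fun 𝒜 ℬ h𝒜 hℬ => ?_⟩
  obtain ⟨φ⟩ := h ℬ.obj ℬ.property (congrArg ObjectProperty.FullSubcategory.obj hℬ) 𝒜.obj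
    ⟨𝒜.property, congrArg ObjectProperty.FullSubcategory.obj h𝒜⟩
  exact ⟨ObjectProperty.homMk φ⟩

theorem isDirectedCategory_of_minimal (hK : Minimal IsHereditaryClass K)
    (hdir : ∀ A B : C, P A → P B → ∃ D : C, P D ∧ Nonempty (A ⟶ D) ∧ Nonempty (B ⟶ D)) :
    IsDirectedCategory (ObjectProperty.FullSubcategory fun 𝒜 : ColoredObject k => 𝒜 ∈ K) := by
  intro 𝒜 ℬ
  obtain ⟨D, hD, h⟩ := exists_forall_hom_of_minimal_of_finite hK hdir
    (Set.toFinite {𝒜.obj, ℬ.obj})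
    (Set.insert_subset 𝒜.property (Set.singleton_subset_iff.2 ℬ.property))
    ⟨_, hK.1.prop _ 𝒜.property⟩
  obtain ⟨𝒟, h𝒟, rfl⟩ := hK.1.exists_mem D hD
  obtain ⟨φ⟩ := h 𝒟 h𝒟 rfl 𝒜.obj (.inl rfl)
  obtain ⟨ψ⟩ := h 𝒟 h𝒟 rfl ℬ.obj (.inr rfl)
  exact ⟨⟨𝒟, h𝒟⟩, ⟨ObjectProperty.homMk φ⟩, ⟨ObjectProperty.homMk ψ⟩⟩

/-- The coloured objects in which every copy of `B A` sees at least `n A` colours on the copies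
of `A`. -/
def colorfulClass (n : P.FullSubcategory → ℕ) (k : P.FullSubcategory → ℕ)
    (B : P.FullSubcategory → P.FullSubcategory) : Set (ColoredObject k) :=
  {𝒳 | P 𝒳.obj ∧ ∀ (A : P.FullSubcategory) (w : (B A).obj ⟶ 𝒳.obj),
    n A ≤ (Set.range fun f : A.obj ⟶ (B A).obj => 𝒳.color A (f ≫ w)).ncard}

theorem isHereditaryClass_colorfulClass {n : P.FullSubcategory → ℕ}
    {B : P.FullSubcategory → P.FullSubcategory}
    (h : ∀ A X : P.FullSubcategory, ∃ χ : (A ⟶ X) → Fin (k A + 1), ∀ w : B A ⟶ X,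
      n A ≤ (Set.range fun f : A ⟶ B A => χ (f ≫ w)).ncard) :
    IsHereditaryClass (colorfulClass n k B) where
  prop 𝒜 h𝒜 := h𝒜.1
  restrict_mem ℬ hℬ A hA f := ⟨hA, fun A' (w : (B A').obj ⟶ A) => by
    have h := hℬ.2 A' (w ≫ f)
    simp only [← Category.assoc] at h
    exact h⟩
  exists_mem X hX := by
    choose χ hχ using fun A => h A ⟨X, hX⟩
    refine ⟨⟨X, fun A e => χ A (ObjectProperty.homMk e)⟩, ⟨hX, fun A w => ?_⟩, rfl⟩
    refine (hχ A (ObjectProperty.homMk w)).trans (le_of_eq (congrArg Set.ncard ?_))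
    exact ObjectProperty.homMk_surjective.range_comp _ |>.symm

/-- A member of `K` over `B A` shows at least `n A` colours on copies of `A`, and the colour of a
copy can be read off its type by evaluating at the identity. -/
theorem le_ncard_fiber {n : P.FullSubcategory → ℕ} {B : P.FullSubcategory → P.FullSubcategory}
    (hK : IsHereditaryClass K) (hKB : K ⊆ colorfulClass n k B) (A : P.FullSubcategory)
    (hfin : {𝒜 : ColoredObject k | 𝒜.obj = A.obj}.Finite) :
    n A ≤ {𝒜 ∈ K | 𝒜.obj = A.obj}.ncard := by
  obtain ⟨ℬ, hℬ, hB⟩ := hK.exists_mem (B A).obj (B A).property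
  have : Finite {𝒜 // 𝒜 ∈ K ∧ 𝒜.obj = A.obj} := hfin.subset fun 𝒜 (h𝒜 : _ ∧ _) => h𝒜.2
  refine ((hKB hℬ).2 A (eqToHom hB.symm)).trans ?_
  refine ncard_range_le_card (γ := {𝒜 // 𝒜 ∈ K ∧ 𝒜.obj = A.obj}) _
    (fun f => ⟨ℬ.restrict (f ≫ eqToHom hB.symm), hK.restrict_mem ℬ hℬ A.property _, rfl⟩)
    fun f g hfg => ?_
  have hcol : (fun X e => ℬ.color X (e ≫ f ≫ eqToHom hB.symm)) =
      fun (X : P.FullSubcategory) (e : X.obj ⟶ A.obj) => ℬ.color X (e ≫ g ≫ eqToHom hB.symm) := by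
    simpa [restrict] using hfg
  simpa using congrFun (congrFun hcol A) (𝟙 A.obj)

theorem hasRamseyProperty_of_minimal (hK : Minimal IsHereditaryClass K)
    (hdir : ∀ A B : C, P A → P B → ∃ D : C, P D ∧ Nonempty (A ⟶ D) ∧ Nonempty (B ⟶ D))
    (hfin : ∀ A : C, P A → {𝒜 : ColoredObject k | 𝒜.obj = A}.Finite)
    (n : P.FullSubcategory → ℕ)
    (hn : ∀ A, n A ≤ {𝒜 ∈ K | 𝒜.obj = A.obj}.ncard)
    (hR : ∀ A : P.FullSubcategory, ∀ l : ℕ, 2 ≤ l → ∀ B, Nonempty (A ⟶ B) →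
      ∃ X, RamseyArrow X B A l (n A)) :
    HasRamseyProperty (ObjectProperty.FullSubcategory fun 𝒜 : ColoredObject k => 𝒜 ∈ K) := by
  rintro l - 𝒜 ℬ ⟨φ⟩
  have h𝒜 := hK.1.prop _ 𝒜.property
  obtain ⟨𝒳, h𝒳, h⟩ := exists_ramseyArrow_of_minimal hK hdir 𝒜.property ℬ.property ⟨φ.hom⟩
    (hfin _ h𝒜) (hn ⟨_, h𝒜⟩) (fun l hl B hB hf => by
      obtain ⟨f⟩ := hf
      obtain ⟨X, hX⟩ := hR ⟨_, h𝒜⟩ l hl ⟨B, hB⟩ ⟨ObjectProperty.homMk f⟩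
      refine ⟨X.obj, X.property, fun χ => ?_⟩
      obtain ⟨w, hw⟩ := hX fun e => χ e.hom
      refine ⟨w.hom, le_trans (le_of_eq (congrArg Set.ncard ?_)) hw⟩
      exact (ObjectProperty.homMk_surjective (P := P) (X := ⟨_, h𝒜⟩) (Y := ⟨B, hB⟩)).range_comp
        fun f => χ (f ≫ w).hom) l
  refine ⟨⟨𝒳, h𝒳⟩, fun χ => ?_⟩
  obtain ⟨w, hw⟩ := h fun e => χ (ObjectProperty.homMk e)
  refine ⟨ObjectProperty.homMk w, ?_⟩
  have : (Set.range fun f : 𝒜 ⟶ ℬ => χ (f ≫ ObjectProperty.homMk w)).Subsingleton := by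
    rintro _ ⟨f, rfl⟩ _ ⟨g, rfl⟩
    exact hw f.hom g.hom
  exact (Set.ncard_le_one (Set.toFinite _)).2 fun a ha b hb => this ha hb

end ColoredObject

end Main

end RamseyExpansion

open RamseyExpansion
open ColoredObject in
theorem mainTheorem3 {C : Type u} [Category.{v} C] (Cfin : ObjectProperty C)
    (hC : IsFiniteTemplate Cfin) (F : C)
    (hom : IsHomogeneous Cfin F) (hlf : IsLocallyFinite Cfin F) :
    HasFiniteRamseyDegrees (Age Cfin F).FullSubcategory ↔
      ∃ (Cstar : Type (max u v)) (_ : Category.{v} Cstar) (U : Cstar ⥤ C),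
        IsExpansion U ∧ IsReasonable U ∧ IsPrecompact Cfin U ∧ HasUniqueRestrictions U ∧
          ∃ (Astar : ObjectProperty Cstar)
            (hA : ∀ 𝒜 : Cstar, Astar 𝒜 → Age Cfin F (U.obj 𝒜)),
            IsDirectedCategory Astar.FullSubcategory ∧
            HasRamseyProperty Astar.FullSubcategory ∧
            IsExpansion (restrictFull U Astar (Age Cfin F) hA) ∧
            HasUniqueRestrictions (restrictFull U Astar (Age Cfin F) hA) ∧
            HasExpansionProperty (restrictFull U Astar (Age Cfin F) hA) := by
  have hle : Age Cfin F ≤ Cfin := fun _ h => h.1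
  constructor
  · intro h
    choose n hR k B hB using fun A => exists_of_ramseyDegree_lt_top (h A)
    have hpre := isPrecompact_forget k hC hle
    have hfin : ∀ A : C, Age Cfin F A → {𝒜 : ColoredObject k | 𝒜.obj = A}.Finite :=
      fun A hA => hpre.finite A hA.1
    obtain ⟨K, hKB, hK⟩ := (isHereditaryClass_colorfulClass hB).exists_minimal hfin
    exact ⟨ColoredObject k, inferInstance, forget k, isExpansion_forget k,
      isReasonable_forget k hC.mono, hpre, hasUniqueRestrictions_forget k,
      fun 𝒜 => 𝒜 ∈ K, hK.1.prop, isDirectedCategory_of_minimal hK hlf.age_directed,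
      hasRamseyProperty_of_minimal hK hlf.age_directed hfin n
        (fun A => le_ncard_fiber hK.1 hKB A (hfin A.obj A.property)) hR,
      isExpansion_restrictFull hK.1, hasUniqueRestrictions_restrictFull hK.1,
      hasExpansionProperty_restrictFull hK hlf.age_directed hfin⟩
  · rintro ⟨Cstar, _, U, -, -, hpre, -, Astar, hA, -, hR, hU, hr, -⟩ A
    refine ramseyDegree_lt_top_of_expansion hU hr hR A ?_
    have := hpre.finite A.obj (hle _ A.property)
    refine Finite.of_injective (β := {𝒜 : Cstar // U.obj 𝒜 = A.obj})
      (fun 𝒜 => ⟨𝒜.1.obj, congrArg ObjectProperty.FullSubcategory.obj 𝒜.2⟩) fun 𝒜 ℬ h => ?_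
    exact Subtype.ext (ObjectProperty.FullSubcategory.ext (congrArg Subtype.val h))
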